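/- Let $\theta\le 8/9$ and set $q_+=\frac{1+\sqrt{1-\theta}}{6}$. For $q_1,q_2,q_3\in H^1(-1,1)$ consider $$Q(x)=\begin{pmatrix}-2q_1(x)&0&0\\0&q_1(x)-q_2(x)&q_3(x)\\0&q_3(x)&q_1(x)+q_2(x)\end{pmatrix},\qquad x\in[-1,1],$$ and let $\mathcal H$ be the set of all such $Q$ satisfying the boundary conditions $q_1(\pm1)=q_+$, $q_2(\pm1)=\mp3q_+$, $q_3(\pm1)=0$. For $\lambda>0$ and $Q\in\mathcal H$ let $$E_\lambda(Q)=\int_{-1}^1\Big(\frac1{2\lambda^2}|Q'|^2+f(Q)\Big)\,dx,\qquad f(Q)=\frac\theta6|Q|^2-\frac23\operatorname{tr}(Q^3)+\frac18|Q|^4+c(\theta),$$ where $|Q|^2=\operatorname{tr}(Q\,{}^tQ)$ and the constant $c(\theta)$ is chosen so that $f$ has minimum $0$ over all traceless symmetric real $3\times3$ matrices. Define $$Q_*(x)=6q_+\Big(n_*(x)\otimes n_*(x)-\frac13I\Big),\qquad n_*(x)=\begin{pmatrix}0\\ \cos\left(\frac\pi4-\frac\pi4x\right)\\ \sin\left(\frac\pi4-\frac\pi4x\right)\end{pmatrix},$$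 so that $n_*$ rotates along a great circle from $n_*(-1)=e_z=(0,0,1)$ to $n_*(1)=e_y=(0,1,0)$. Then $Q_*\in\mathcal H$, and minimizers $Q_\lambda$ of $E_\lambda$ over $\mathcal H$ with $q_3(0)\ge0$ satisfy $$Q_\lambda\to Q_*\quad\text{in }H^1(-1,1)\quad\text{as }\lambda\to+\infty;$$ that is, for every $\varepsilon>0$ there is $\Lambda>0$ such that for all $\lambda\ge\Lambda$, every minimizer $Q$ of $E_\lambda$ over $\mathcal H$ with $q_3(0)\ge0$ satisfies $\|Q-Q_*\|_{H^1(-1,1)}<\varepsilon$. -/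

import Mathlib

open MeasureTheory Set

namespace HybridCell

noncomputable section

/-- Real `3 × 3` matrices; rows and columns are indexed by `0, 1, 2` for `e_x, e_y, e_z`. -/
abbrev Mat3 : Type := Matrix (Fin 3) (Fin 3) ℝ

/-- The squared Euclidean (Frobenius) norm `|A|² = tr(A Aᵀ) = ∑ Aᵢⱼ²`. -/
def normSq (A : Mat3) : ℝ := ∑ i, ∑ j, A i j ^ 2

/-- The space of `Q`-tensors: traceless symmetric matrices. -/
def qTensors : Set Mat3 := {A | A.IsSymm ∧ A.trace = 0}

/-- The `Q`-tensor with coordinates `(q₁, q₂, q₃)`, having `e_x` as an eigenvector. -/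
def qTensor (q₁ q₂ q₃ : ℝ) : Mat3 :=
  !![-2 * q₁, 0, 0;
     0, q₁ - q₂, q₃;
     0, q₃, q₁ + q₂]

/-- The bulk energy density without its additive constant. -/
def bulk (θ : ℝ) (A : Mat3) : ℝ :=
  θ / 6 * normSq A - 2 / 3 * (A ^ 3).trace + 1 / 8 * normSq A ^ 2

/-- The additive constant `c(θ)`, chosen so that the bulk energy density `f` has minimum `0` over
all `Q`-tensors. -/
def bulkConst (θ : ℝ) : ℝ := -sInf (bulk θ '' qTensors)

/-- The reduced bulk energy density `f`. -/
def f (θ : ℝ) (A : Mat3) : ℝ := bulk θ A + bulkConst θ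

/-- `q₊ = (1 + √(1 - θ)) / 6`. -/
def qPlus (θ : ℝ) : ℝ := (1 + Real.sqrt (1 - θ)) / 6

/-- `u` is (the continuous representative of) an element of `H¹(-1, 1)`: it is absolutely
continuous on `[-1, 1]` and its (almost everywhere defined) derivative is square integrable. -/
def IsH1 (u : ℝ → ℝ) : Prop :=
  AbsolutelyContinuousOnInterval u (-1) 1 ∧ MemLp (deriv u) 2 (volume.restrict (Ioo (-1) 1))

/-- The entrywise derivative of a matrix-valued map. -/
def derivMat (Q : ℝ → Mat3) (x : ℝ) : Mat3 := Matrix.of fun i j => deriv (fun y => Q y i j) x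

/-- The admissible configurations: `H¹` maps on `[-1, 1]` of the form `qTensor q₁ q₂ q₃`, uniaxial
with director `e_z` at `x = -1` and with director `e_y` at `x = 1`. -/
def admissible (θ : ℝ) : Set (ℝ → Mat3) :=
  {Q | ∃ q₁ q₂ q₃ : ℝ → ℝ, IsH1 q₁ ∧ IsH1 q₂ ∧ IsH1 q₃ ∧
    (∀ x ∈ Icc (-1 : ℝ) 1, Q x = qTensor (q₁ x) (q₂ x) (q₃ x)) ∧
    q₁ (-1) = qPlus θ ∧ q₁ 1 = qPlus θ ∧
    q₂ (-1) = 3 * qPlus θ ∧ q₂ 1 = -3 * qPlus θ ∧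
    q₃ (-1) = 0 ∧ q₃ 1 = 0}

/-- The reduced free energy `E_λ`. -/
def energy (θ lam : ℝ) (Q : ℝ → Mat3) : ℝ :=
  ∫ x in (-1 : ℝ)..1, (1 / (2 * lam ^ 2) * normSq (derivMat Q x) + f θ (Q x))

/-- `Q` minimizes `E_λ` among all admissible configurations. -/
def IsMinimizer (θ lam : ℝ) (Q : ℝ → Mat3) : Prop :=
  Q ∈ admissible θ ∧ ∀ P ∈ admissible θ, energy θ lam Q ≤ energy θ lam P

/-- The `H¹(-1, 1)` norm of a matrix-valued map. -/
def h1Norm (Q : ℝ → Mat3) : ℝ :=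
  Real.sqrt (∫ x in (-1 : ℝ)..1, (normSq (Q x) + normSq (derivMat Q x)))

/-- The uniaxial tensor `6 q₊ (n ⊗ n - I / 3)` with director `n`. -/
def uniaxial (θ : ℝ) (n : Fin 3 → ℝ) : Mat3 :=
  (6 * qPlus θ) • (Matrix.vecMulVec n n - (1 / 3 : ℝ) • (1 : Mat3))

/-- The limiting director `n_*`. -/
def nStar (x : ℝ) : Fin 3 → ℝ :=
  ![0, Real.cos (Real.pi / 4 - Real.pi / 4 * x), Real.sin (Real.pi / 4 - Real.pi / 4 * x)]

/-- The limiting map `Q_*`. -/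
def QStar (θ : ℝ) (x : ℝ) : Mat3 := uniaxial θ (nStar x)

end

end HybridCell

/-!
In the coordinates `(a, b, c)` of `qTensor a b c` the squared norm of the derivative is
`6 a'² + 2 (b'² + c'²)`, and `f` vanishes on the circle `a = q₊`, `b² + c² = R²` with `R = 3 q₊`.
It has further zeros in this three-dimensional space, namely a uniaxial tensor with director `e_x`
and, if `θ = 8/9`, the origin. The limiting map runs through the upper half of the circle at
constant speed, so that `b = -R sin (πx/2)` and `c = R cos (πx/2)`.

The bulk energy is made explicit by writing its excess over the minimum as a sum of two nonnegative
terms (`bulk_qTensor`); with the spectral theorem this determines `bulkConst` (`bulkConst_eq`).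
Comparing a minimizer with `QStar`, on which `f` vanishes, gives
`3 ∫ a'² + ∫ b'² + ∫ c'² + λ² ∫ f(Q) ≤ (π²/2) R²` (`IsMinimizer.bound`). Hence `∫ f(Q)` is of order
`λ⁻²`, and by equicontinuity `f(Q)` is uniformly small (`exists_forall_excess_lt`). Since the curve
starts on the circle and the circle is separated from the other zeros of `f`, the curve stays near
the circle (`exists_forall_abs_sub_le`), so `b² + c²` is uniformly close to `R²`.

It remains to exploit the bound on the Dirichlet energy, and this is done without weak compactness.
For `u(-1) = -u(1)` let `g` be the solution of `g'' = -(π/2)² g` that agrees with `u` at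
`-1`, `0`, `1`, and `w = u - g`. Integration by parts gives
`∫ u'² - (π/2)² ∫ u² = ∫ w'² - (π/2)² ∫ w²`. As `w` has three zeros, a crude Poincaré inequality
bounds the right side below by a multiple of `∫ w'²` (`integral_deriv_sub_arc_sq_le`). Summing over
`b` and `c`, the energy bound together with `b² + c² ≈ R²` shows that `a'` and both remainders are
small in `L²`. So `(b, c)` is close to `(-R sin + b(0) cos, c(0) cos)` at `πx/2`, and
`b² + c² ≈ R²` at `x = 0, ±1/2` forces `b(0) ≈ 0` and `c(0) ≈ ±R`; the condition `c(0) ≥ 0` selects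
the sign (`exists_h1Sq_sub_le`).
-/

namespace HybridCell

/-! ### The bulk energy -/

theorem normSq_qTensor (a b c : ℝ) :
    normSq (qTensor a b c) = 6 * a ^ 2 + 2 * (b ^ 2 + c ^ 2) := by
  simp [normSq, qTensor, Fin.sum_univ_three]
  ring

theorem trace_cube_qTensor (a b c : ℝ) :
    ((qTensor a b c) ^ 3).trace = 6 * a * (b ^ 2 + c ^ 2) - 6 * a ^ 3 := by
  simp [Matrix.trace, qTensor, pow_succ, Fin.sum_univ_three]
  ring

theorem qTensor_mem_qTensors (a b c : ℝ) : qTensor a b c ∈ qTensors := by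
  refine ⟨?_, ?_⟩
  · ext i j
    fin_cases i <;> fin_cases j <;> simp [qTensor]
  · simp [Matrix.trace, qTensor, Fin.sum_univ_three]
    ring

theorem qPlus_pos (θ : ℝ) : 0 < qPlus θ := by
  unfold qPlus; positivity

/-- `q₊` is the larger root of `36 q² - 12 q + θ = 0`, the critical point equation for the bulk
energy of nonzero uniaxial tensors of size `6 q`. -/
theorem eq_qPlus {θ : ℝ} (hθ : θ ≤ 8 / 9) : θ = 12 * qPlus θ - 36 * qPlus θ ^ 2 := by
  have h := Real.sq_sqrt (show 0 ≤ 1 - θ by linarith)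
  unfold qPlus
  linarith

theorem two_ninths_le_qPlus {θ : ℝ} (hθ : θ ≤ 8 / 9) : 2 / 9 ≤ qPlus θ := by
  have h : 1 / 3 ≤ √(1 - θ) := Real.le_sqrt_of_sq_le (by linarith)
  unfold qPlus
  linarith

/-- The size `s = √(3/2) |Q|` of `qTensor a b c`; a uniaxial tensor `s (n ⊗ n - I / 3)` with
`0 ≤ s` has size `s`. -/
noncomputable def size (a b c : ℝ) : ℝ := √(9 * a ^ 2 + 3 * (b ^ 2 + c ^ 2))

theorem size_sq (a b c : ℝ) : size a b c ^ 2 = 9 * a ^ 2 + 3 * (b ^ 2 + c ^ 2) :=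
  Real.sq_sqrt (by positivity)

theorem size_nonneg (a b c : ℝ) : 0 ≤ size a b c := Real.sqrt_nonneg _

theorem neg_three_mul_le_size (a b c : ℝ) : -(3 * a) ≤ size a b c :=
  Real.le_sqrt_of_sq_le (by nlinarith [sq_nonneg b, sq_nonneg c])

/-- The excess of the bulk energy over its minimum, as a sum of two terms: the first measures how
far the size is from its optimal value `6 q₊`; the second vanishes exactly on the uniaxial tensors
of nonnegative scalar order, with the squared factor for directors orthogonal to `e_x` and the last
factor for the director `e_x`. -/
noncomputable def excess (q a b c : ℝ) : ℝ :=
  1 / 18 * (size a b c - 6 * q) ^ 2 *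
      (size a b c ^ 2 + (12 * q - 8 / 3) * size a b c + 36 * q ^ 2 - 8 * q) +
    4 / 27 * (size a b c - 6 * a) ^ 2 * (size a b c + 3 * a)

theorem bulk_qTensor {θ : ℝ} (hθ : θ ≤ 8 / 9) (a b c : ℝ) :
    bulk θ (qTensor a b c) =
      16 * qPlus θ ^ 3 - 72 * qPlus θ ^ 4 + excess (qPlus θ) a b c := by
  have h := eq_qPlus hθ
  have hs := size_sq a b c
  unfold bulk excess
  rw [normSq_qTensor, trace_cube_qTensor]
  generalize qPlus θ = q at *
  generalize size a b c = s at *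
  have hr : b ^ 2 + c ^ 2 = s ^ 2 / 3 - 3 * a ^ 2 := by linarith
  rw [hr, h]
  ring

theorem excess_nonneg {θ : ℝ} (hθ : θ ≤ 8 / 9) (a b c : ℝ) : 0 ≤ excess (qPlus θ) a b c := by
  have h1 := two_ninths_le_qPlus hθ
  have h2 := size_nonneg a b c
  have h3 := neg_three_mul_le_size a b c
  have h4 : 0 ≤ (12 * qPlus θ - 8 / 3) * size a b c := mul_nonneg (by linarith) h2
  have h5 : 0 ≤ 36 * qPlus θ ^ 2 - 8 * qPlus θ := by nlinarith
  have h6 : 0 ≤ size a b c ^ 2 + (12 * qPlus θ - 8 / 3) * size a b c + 36 * qPlus θ ^ 2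
      - 8 * qPlus θ := by nlinarith [sq_nonneg (size a b c)]
  have h7 : 0 ≤ size a b c + 3 * a := by linarith
  unfold excess
  positivity

/-- On the circle of uniaxial tensors with director orthogonal to `e_x` the excess vanishes. -/
theorem excess_eq_zero {q b c : ℝ} (hq : 0 ≤ q) (h : b ^ 2 + c ^ 2 = 9 * q ^ 2) :
    excess q q b c = 0 := by
  have hs : size q b c = 6 * q := by
    unfold size
    rw [h, show 9 * q ^ 2 + 3 * (9 * q ^ 2) = (6 * q) ^ 2 by ring]
    exact Real.sqrt_sq (by positivity)
  simp [excess, hs]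

/-- By diagonalization, every `Q`-tensor has the same bulk energy as a diagonal one. -/
theorem exists_bulk_eq_bulk_qTensor (θ : ℝ) {A : Mat3} (hA : A ∈ qTensors) :
    ∃ a b : ℝ, bulk θ A = bulk θ (qTensor a b 0) := by
  obtain ⟨hs, ht⟩ := hA
  have hH : A.IsHermitian := by
    rw [Matrix.IsHermitian, Matrix.conjTranspose_eq_transpose_of_trivial]; exact hs
  set d := hH.eigenvalues with hd
  set D : Mat3 := Matrix.diagonal d with hD
  have htr (B : Mat3) :
      (Unitary.conjStarAlgAut ℝ _ hH.eigenvectorUnitary B).trace = B.trace := by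
    rw [Unitary.conjStarAlgAut_apply, Matrix.trace_mul_cycle]
    simp
  have hAD : A = Unitary.conjStarAlgAut ℝ _ hH.eigenvectorUnitary D := by
    have := hH.spectral_theorem
    simpa [hD, hd, Function.comp_def] using this
  have hpow (n : ℕ) : (A ^ n).trace = (D ^ n).trace := by
    conv_lhs => rw [hAD, ← map_pow, htr]
  have hn (B : Mat3) (hB : B.IsSymm) : normSq B = (B ^ 2).trace := by
    simp only [normSq, Matrix.trace, Matrix.diag_apply, sq, Matrix.mul_apply]
    refine Finset.sum_congr rfl fun i _ => Finset.sum_congr rfl fun j _ => ?_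
    rw [hB.apply i j]
  have hDs : D.IsSymm := Matrix.isSymm_diagonal d
  have h0 : d 0 + d 1 + d 2 = 0 := by
    have := hpow 1
    rw [pow_one, pow_one, ht] at this
    simpa [hD, Matrix.trace, Fin.sum_univ_three] using this.symm
  have hDq : D = qTensor (-d 0 / 2) ((d 2 - d 1) / 2) 0 := by
    ext i j
    fin_cases i <;> fin_cases j <;> simp [hD, qTensor] <;> linarith
  refine ⟨-d 0 / 2, (d 2 - d 1) / 2, ?_⟩
  rw [← hDq]
  unfold bulk
  rw [hn A hs, hn D hDs, hpow, hpow]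

theorem bulkConst_eq {θ : ℝ} (hθ : θ ≤ 8 / 9) :
    bulkConst θ = 72 * qPlus θ ^ 4 - 16 * qPlus θ ^ 3 := by
  have h : IsLeast (bulk θ '' qTensors) (16 * qPlus θ ^ 3 - 72 * qPlus θ ^ 4) := by
    constructor
    · refine ⟨qTensor (qPlus θ) (3 * qPlus θ) 0, qTensor_mem_qTensors _ _ _, ?_⟩
      rw [bulk_qTensor hθ, excess_eq_zero (qPlus_pos θ).le (by ring), add_zero]
    · rintro _ ⟨A, hA, rfl⟩
      obtain ⟨a, b, hab⟩ := exists_bulk_eq_bulk_qTensor θ hA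
      rw [hab, bulk_qTensor hθ]
      linarith [excess_nonneg hθ a b 0]
  rw [bulkConst, h.csInf_eq]
  ring

theorem f_qTensor {θ : ℝ} (hθ : θ ≤ 8 / 9) (a b c : ℝ) :
    f θ (qTensor a b c) = excess (qPlus θ) a b c := by
  rw [f, bulk_qTensor hθ, bulkConst_eq hθ]
  ring

theorem continuous_excess (q : ℝ) :
    Continuous fun p : ℝ × ℝ × ℝ => excess q p.1 p.2.1 p.2.2 := by
  unfold excess size
  fun_prop

/-- Where `Q` has size at distance `δ` from the optimal one, the excess is bounded below. -/
theorem le_excess_of_abs_size_sub_eq {θ δ a b c : ℝ} (hθ : θ ≤ 8 / 9) (hδ : δ ≤ 3 * qPlus θ)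
    (h : |size a b c - 6 * qPlus θ| = δ) :
    1 / 2 * δ ^ 2 * qPlus θ ^ 2 ≤ excess (qPlus θ) a b c := by
  have h1 := two_ninths_le_qPlus hθ
  have h2 : 3 * qPlus θ ≤ size a b c := by linarith [neg_le_of_abs_le h.le]
  have h3 := neg_three_mul_le_size a b c
  have hsq : (size a b c - 6 * qPlus θ) ^ 2 = δ ^ 2 := by rw [← h, sq_abs]
  have h4 : 0 ≤ (12 * qPlus θ - 8 / 3) * size a b c := mul_nonneg (by linarith) (by linarith)
  have h5 : 0 ≤ 36 * qPlus θ ^ 2 - 8 * qPlus θ := by nlinarith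
  have h6 : 9 * qPlus θ ^ 2 ≤ size a b c ^ 2 + (12 * qPlus θ - 8 / 3) * size a b c
      + 36 * qPlus θ ^ 2 - 8 * qPlus θ := by nlinarith
  have h7 : 0 ≤ 4 / 27 * (size a b c - 6 * a) ^ 2 * (size a b c + 3 * a) :=
    mul_nonneg (by positivity) (by linarith)
  have h8 := mul_le_mul_of_nonneg_left h6 (show 0 ≤ 1 / 18 * δ ^ 2 by positivity)
  rw [excess, hsq]
  linarith

/-- Where the size of `Q` is nearly optimal but `6 a` is at distance `δ` from it, the excess is
bounded below. -/
theorem le_excess_of_abs_size_sub_six_mul_eq {θ δ a b c : ℝ} (hθ : θ ≤ 8 / 9)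
    (hδ : δ ≤ 3 * qPlus θ) (hs : |size a b c - 6 * qPlus θ| ≤ δ) (h : |size a b c - 6 * a| = δ) :
    4 / 9 * δ ^ 2 * qPlus θ ≤ excess (qPlus θ) a b c := by
  have h1 := two_ninths_le_qPlus hθ
  have h2 : 3 * qPlus θ ≤ size a b c := by linarith [neg_le_of_abs_le hs]
  have ha : 0 ≤ a := by linarith [le_of_abs_le h.le]
  have hsq : (size a b c - 6 * a) ^ 2 = δ ^ 2 := by rw [← h, sq_abs]
  have h4 : 0 ≤ (12 * qPlus θ - 8 / 3) * size a b c := mul_nonneg (by linarith) (by linarith)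
  have h5 : 0 ≤ 36 * qPlus θ ^ 2 - 8 * qPlus θ := by nlinarith
  have h6 : 0 ≤ size a b c ^ 2 + (12 * qPlus θ - 8 / 3) * size a b c
      + 36 * qPlus θ ^ 2 - 8 * qPlus θ := by nlinarith [sq_nonneg (size a b c)]
  have h7 : 0 ≤ 1 / 18 * (size a b c - 6 * qPlus θ) ^ 2 * (size a b c ^ 2
      + (12 * qPlus θ - 8 / 3) * size a b c + 36 * qPlus θ ^ 2 - 8 * qPlus θ) := by positivity
  have h8 : 3 * qPlus θ ≤ size a b c + 3 * a := by linarith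
  have h9 := mul_le_mul_of_nonneg_left h8 (show 0 ≤ 4 / 27 * δ ^ 2 by positivity)
  rw [excess, hsq]
  linarith

/-- If size and first coordinate are nearly optimal, `Q` is near the circle of minimizers. -/
theorem abs_sq_add_sq_sub_le {q δ a b c : ℝ} (hδ : δ ≤ 3 * q)
    (hs : |size a b c - 6 * q| ≤ δ) (ha : |size a b c - 6 * a| ≤ δ) :
    |b ^ 2 + c ^ 2 - 9 * q ^ 2| ≤ 12 * q * δ := by
  have h := size_sq a b c
  obtain ⟨e, he⟩ : ∃ e, e = size a b c - 6 * q := ⟨_, rfl⟩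
  obtain ⟨g, hg⟩ : ∃ g, g = size a b c - 6 * a := ⟨_, rfl⟩
  rw [← he] at hs
  rw [← hg] at ha
  have hr : b ^ 2 + c ^ 2 - 9 * q ^ 2 =
      3 * q * e + q * g + (3 * e ^ 2 + 2 * (e * g) - g ^ 2) / 12 := by
    rw [show b ^ 2 + c ^ 2 = size a b c ^ 2 / 3 - 3 * a ^ 2 by linarith,
      show size a b c = e + 6 * q by linarith, show a = (e + 6 * q - g) / 6 by linarith]
    ring
  have h0 : 0 ≤ δ := (abs_nonneg _).trans hs
  have h1 : e ^ 2 ≤ δ ^ 2 := sq_le_sq' (neg_le_of_abs_le hs) (le_of_abs_le hs)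
  have h2 : g ^ 2 ≤ δ ^ 2 := sq_le_sq' (neg_le_of_abs_le ha) (le_of_abs_le ha)
  have h3 : |e * g| ≤ δ ^ 2 := by
    rw [abs_mul, sq]
    gcongr
  have h4 : δ ^ 2 ≤ 3 * q * δ := by rw [sq]; gcongr
  have hq : 0 ≤ q := by linarith
  have h5 : |q * e| ≤ q * δ := by rw [abs_mul, abs_of_nonneg hq]; gcongr
  have h6 : |q * g| ≤ q * δ := by rw [abs_mul, abs_of_nonneg hq]; gcongr
  rw [hr]
  rw [abs_le] at h3 h5 h6 ⊢
  constructor <;> linarith [sq_nonneg e, sq_nonneg g]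

/-! ### Functions in `H¹(-1, 1)` -/

theorem sq_integral_le {g : ℝ → ℝ} {a b : ℝ} (hab : a ≤ b) (hg : IntervalIntegrable g volume a b)
    (hg2 : IntervalIntegrable (fun x => g x ^ 2) volume a b) :
    (∫ x in a..b, g x) ^ 2 ≤ (b - a) * ∫ x in a..b, g x ^ 2 := by
  rcases hab.eq_or_lt with rfl | hlt
  · simp
  set I := ∫ x in a..b, g x with hI
  set m := I / (b - a) with hm
  have hpos : 0 < b - a := sub_pos.2 hlt
  have h0 : 0 ≤ ∫ x in a..b, (g x - m) ^ 2 :=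
    intervalIntegral.integral_nonneg hab fun x _ => sq_nonneg _
  have h1 : ∫ x in a..b, (g x - m) ^ 2 = (∫ x in a..b, g x ^ 2) - 2 * m * I + (b - a) * m ^ 2 := by
    have : (fun x => (g x - m) ^ 2) = fun x => g x ^ 2 - 2 * m * g x + m ^ 2 := by
      funext x; ring
    rw [this, intervalIntegral.integral_add (hg2.sub (hg.const_mul _)) (by simp),
      intervalIntegral.integral_sub hg2 (hg.const_mul _), intervalIntegral.integral_const_mul,
      intervalIntegral.integral_const, smul_eq_mul]
  have hIm : I = m * (b - a) := by rw [hm]; field_simp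
  rw [h1] at h0
  have h2 := mul_nonneg hpos.le h0
  rw [hIm] at h2 ⊢
  nlinarith

namespace IsH1

variable {u v : ℝ → ℝ}

theorem continuousOn (hu : IsH1 u) : ContinuousOn u (Icc (-1) 1) := by
  simpa [uIcc_of_le] using hu.1.continuousOn

theorem ae_differentiableAt (hu : IsH1 u) :
    ∀ᵐ x ∂volume.restrict (Ioo (-1 : ℝ) 1), DifferentiableAt ℝ u x := by
  rw [ae_restrict_iff' measurableSet_Ioo]
  filter_upwards [hu.1.ae_differentiableAt] with x hx hx'
  exact hx (by rw [uIcc_of_le (by norm_num)]; exact Ioo_subset_Icc_self hx')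

theorem sub (hu : IsH1 u) (hv : IsH1 v) : IsH1 fun x => u x - v x := by
  refine ⟨hu.1.fun_sub hv.1, (hu.2.sub hv.2).ae_eq ?_⟩
  filter_upwards [hu.ae_differentiableAt, hv.ae_differentiableAt] with x hx hx'
  exact (deriv_fun_sub hx hx').symm

theorem of_contDiff (hu : ContDiff ℝ 1 u) : IsH1 u := by
  refine ⟨hu.contDiffOn.absolutelyContinuousOnInterval, ?_⟩
  have hc : Continuous (deriv u) := hu.continuous_deriv le_rfl
  obtain ⟨C, hC⟩ := isCompact_Icc.exists_bound_of_continuousOn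
    (hc.continuousOn : ContinuousOn (deriv u) (Icc (-1) 1))
  refine MemLp.of_bound hc.aestronglyMeasurable C ?_
  rw [ae_restrict_iff' measurableSet_Ioo]
  exact Filter.Eventually.of_forall fun x hx => hC x (Ioo_subset_Icc_self hx)

theorem intervalIntegrable_deriv_sq (hu : IsH1 u) :
    IntervalIntegrable (fun x => deriv u x ^ 2) volume (-1) 1 := by
  rw [intervalIntegrable_iff_integrableOn_Ioo_of_le (by norm_num)]
  exact hu.2.integrable_sq

theorem intervalIntegrable_sq (hu : IsH1 u) :
    IntervalIntegrable (fun x => u x ^ 2) volume (-1) 1 := by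
  refine ContinuousOn.intervalIntegrable ?_
  rw [uIcc_of_le (by norm_num)]
  exact hu.continuousOn.pow 2

theorem integral_deriv_sq_nonneg (u : ℝ → ℝ) : 0 ≤ ∫ x in (-1 : ℝ)..1, deriv u x ^ 2 :=
  intervalIntegral.integral_nonneg (by norm_num) fun _ _ => sq_nonneg _

/-- The Hölder estimate of exponent `1/2` for `H¹` functions. -/
theorem sq_sub_le (hu : IsH1 u) {a b x y : ℝ} (ha : -1 ≤ a) (hb : b ≤ 1)
    (hx : x ∈ Icc a b) (hy : y ∈ Icc a b) :
    (u y - u x) ^ 2 ≤ |y - x| * ∫ t in a..b, deriv u t ^ 2 := by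
  wlog hxy : x ≤ y generalizing x y
  · rw [abs_sub_comm, ← neg_sq, neg_sub]
    exact this hy hx (le_of_not_ge hxy)
  have hab : a ≤ b := hx.1.trans hx.2
  have hsub : uIcc x y ⊆ uIcc (-1) 1 := by
    rw [uIcc_of_le hxy, uIcc_of_le (by norm_num)]
    exact Icc_subset_Icc (ha.trans hx.1) (hy.2.trans hb)
  have hac := hu.1.mono hsub
  have hsub' : uIcc x y ⊆ uIcc a b := by
    rw [uIcc_of_le hxy, uIcc_of_le hab]
    exact Icc_subset_Icc hx.1 hy.2
  have hab1 : IntervalIntegrable (fun x => deriv u x ^ 2) volume a b :=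
    hu.intervalIntegrable_deriv_sq.mono_set (by
      rw [uIcc_of_le hab, uIcc_of_le (by norm_num)]
      exact Icc_subset_Icc ha hb)
  rw [← hac.integral_deriv_eq_sub, abs_of_nonneg (sub_nonneg.2 hxy)]
  refine (sq_integral_le hxy hac.intervalIntegrable_deriv (hab1.mono_set hsub')).trans ?_
  refine mul_le_mul_of_nonneg_left ?_ (sub_nonneg.2 hxy)
  exact intervalIntegral.integral_mono_interval hx.1 hxy hy.2
    (Filter.Eventually.of_forall fun _ => sq_nonneg _) hab1

/-- A Poincaré inequality for functions with a zero `c` in `[a, b]`. -/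
theorem integral_sq_le_of_eq_zero (hu : IsH1 u) {a b c : ℝ} (ha : -1 ≤ a) (hb : b ≤ 1)
    (hc : c ∈ Icc a b) (h0 : u c = 0) :
    ∫ x in a..b, u x ^ 2 ≤ (b - a) ^ 2 * ∫ x in a..b, deriv u x ^ 2 := by
  have hab : a ≤ b := hc.1.trans hc.2
  have hD : 0 ≤ ∫ x in a..b, deriv u x ^ 2 :=
    intervalIntegral.integral_nonneg hab fun _ _ => sq_nonneg _
  have h1 : ∫ x in a..b, u x ^ 2 ≤ ∫ x in a..b, (b - a) * ∫ x in a..b, deriv u x ^ 2 := by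
    refine intervalIntegral.integral_mono_on hab ?_ (by simp) fun x hx => ?_
    · refine hu.intervalIntegrable_sq.mono_set ?_
      rw [uIcc_of_le hab, uIcc_of_le (by norm_num)]
      exact Icc_subset_Icc ha hb
    · have := hu.sq_sub_le ha hb hc hx
      rw [h0, sub_zero] at this
      refine this.trans (mul_le_mul_of_nonneg_right ?_ hD)
      rw [abs_le]
      constructor <;> linarith [hx.1, hx.2, hc.1, hc.2]
  refine h1.trans (le_of_eq ?_)
  rw [intervalIntegral.integral_const, smul_eq_mul]
  ring

/-- A Poincaré inequality for functions with zeros at `-1`, `0` and `1`. The constant `1 / 4` is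
not optimal; it matters only that it is smaller than `(2 / π) ^ 2`. -/
theorem integral_sq_le_of_three_zeros (hu : IsH1 u) (h1 : u (-1) = 0) (h2 : u 0 = 0)
    (h3 : u 1 = 0) :
    ∫ x in (-1 : ℝ)..1, u x ^ 2 ≤ 1 / 4 * ∫ x in (-1 : ℝ)..1, deriv u x ^ 2 := by
  have hsplit {g : ℝ → ℝ} (hg : IntervalIntegrable g volume (-1) 1) :
      ∫ x in (-1 : ℝ)..1, g x = (∫ x in (-1 : ℝ)..(-1 / 2), g x) + (∫ x in (-1 / 2 : ℝ)..0, g x)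
        + (∫ x in (0 : ℝ)..(1 / 2), g x) + ∫ x in (1 / 2 : ℝ)..1, g x := by
    have h {a b : ℝ} (ha : -1 ≤ a) (hab : a ≤ b) (hb : b ≤ 1) : IntervalIntegrable g volume a b :=
      hg.mono_set (by
        rw [uIcc_of_le hab, uIcc_of_le (by norm_num)]
        exact Icc_subset_Icc ha hb)
    rw [intervalIntegral.integral_add_adjacent_intervals,
      intervalIntegral.integral_add_adjacent_intervals,
      intervalIntegral.integral_add_adjacent_intervals] <;> apply h <;> norm_num
  rw [hsplit hu.intervalIntegrable_sq, hsplit hu.intervalIntegrable_deriv_sq]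
  have e1 := hu.integral_sq_le_of_eq_zero (a := -1) (b := -1 / 2) (c := -1) (by norm_num)
    (by norm_num) (by norm_num) h1
  have e2 := hu.integral_sq_le_of_eq_zero (a := -1 / 2) (b := 0) (c := 0) (by norm_num)
    (by norm_num) (by norm_num) h2
  have e3 := hu.integral_sq_le_of_eq_zero (a := 0) (b := 1 / 2) (c := 0) (by norm_num)
    (by norm_num) (by norm_num) h2
  have e4 := hu.integral_sq_le_of_eq_zero (a := 1 / 2) (b := 1) (c := 1) (by norm_num)
    (by norm_num) (by norm_num) h3
  norm_num at e1 e2 e3 e4 ⊢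
  linarith

end IsH1

/-! ### Arcs and a coercivity estimate -/

/-- The solution of `g'' = -(π / 2)² g` with `g 0 = β` and `g (±1) = ±α`. -/
noncomputable def arc (α β x : ℝ) : ℝ :=
  α * Real.sin (Real.pi / 2 * x) + β * Real.cos (Real.pi / 2 * x)

theorem hasDerivAt_arc (α β x : ℝ) :
    HasDerivAt (arc α β) (Real.pi / 2 * arc (-β) α x) x := by
  have h : HasDerivAt (fun y : ℝ => Real.pi / 2 * y) (Real.pi / 2) x := by
    simpa using (hasDerivAt_id x).const_mul (Real.pi / 2)
  refine ((h.sin.const_mul α).add (h.cos.const_mul β)).congr_deriv ?_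
  simp only [arc]; ring

theorem deriv_arc (α β : ℝ) : deriv (arc α β) = fun x => Real.pi / 2 * arc (-β) α x :=
  funext fun x => (hasDerivAt_arc α β x).deriv

theorem contDiff_arc (α β : ℝ) {n : WithTop ℕ∞} : ContDiff ℝ n (arc α β) := by
  unfold arc; fun_prop

theorem arc_neg_one (α β : ℝ) : arc α β (-1) = -α := by simp [arc]
theorem arc_zero (α β : ℝ) : arc α β 0 = β := by simp [arc]
theorem arc_one (α β : ℝ) : arc α β 1 = α := by simp [arc]

theorem arc_half (α β : ℝ) : arc α β (1 / 2) = √2 / 2 * (α + β) := by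
  have : Real.pi / 2 * (1 / 2) = Real.pi / 4 := by ring
  rw [arc, this, Real.sin_pi_div_four, Real.cos_pi_div_four]; ring

theorem arc_neg_half (α β : ℝ) : arc α β (-1 / 2) = √2 / 2 * (β - α) := by
  have : Real.pi / 2 * (-1 / 2) = -(Real.pi / 4) := by ring
  rw [arc, this, Real.sin_neg, Real.cos_neg, Real.sin_pi_div_four, Real.cos_pi_div_four]; ring

theorem integral_arc_sq (α β : ℝ) : ∫ x in (-1 : ℝ)..1, arc α β x ^ 2 = α ^ 2 + β ^ 2 := by
  -- a primitive of `arc α β ^ 2`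
  have h (x : ℝ) : HasDerivAt (fun y => (α ^ 2 + β ^ 2) / 2 * y
      - 2 / Real.pi * (1 / 2 * arc α β y * arc (-β) α y)) (arc α β x ^ 2) x := by
    have := ((hasDerivAt_id x).const_mul ((α ^ 2 + β ^ 2) / 2)).sub
      ((((hasDerivAt_arc α β x).const_mul (1 / 2)).mul (hasDerivAt_arc (-β) α x)).const_mul
        (2 / Real.pi))
    refine this.congr_deriv ?_
    have hp := Real.sin_sq_add_cos_sq (Real.pi / 2 * x)
    have := Real.pi_ne_zero
    simp only [arc]
    generalize Real.sin (Real.pi / 2 * x) = S at *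
    generalize Real.cos (Real.pi / 2 * x) = T at *
    field_simp
    linear_combination (-(α ^ 2 + β ^ 2)) * hp
  rw [intervalIntegral.integral_eq_sub_of_hasDerivAt (fun x _ => h x)
    ((contDiff_arc α β (n := 0)).continuous.pow 2 |>.intervalIntegrable _ _)]
  simp only [arc_one, arc_neg_one]
  ring

/-- The functional `∫ (u')² - (π / 2)² u²` vanishes on arcs, and subtracting from `u` the arc that
agrees with it at `-1`, `0` and `1` does not change its value. The remainder has three zeros, which
makes the functional coercive on it. -/
theorem integral_deriv_sub_arc_sq_le {u : ℝ → ℝ} (hu : IsH1 u) (h : u (-1) = -u 1) :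
    3 / 8 * ∫ x in (-1 : ℝ)..1, deriv (fun y => u y - arc (u 1) (u 0) y) x ^ 2 ≤
      (∫ x in (-1 : ℝ)..1, deriv u x ^ 2) - (Real.pi / 2) ^ 2 * ∫ x in (-1 : ℝ)..1, u x ^ 2 := by
  set g := arc (u 1) (u 0) with hgdef
  set g' := arc (-u 0) (u 1) with hg'def
  set w := fun y => u y - g y with hw
  set k := Real.pi / 2 with hk
  have hgH : IsH1 g := IsH1.of_contDiff (contDiff_arc _ _)
  have hg'H : IsH1 g' := IsH1.of_contDiff (contDiff_arc _ _)
  have hwH : IsH1 w := hu.sub hgH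
  have hw1 : w (-1) = 0 := by simp [hw, hgdef, arc_neg_one, h]
  have hw2 : w 0 = 0 := by simp [hw, hgdef, arc_zero]
  have hw3 : w 1 = 0 := by simp [hw, hgdef, arc_one]
  have hP := hwH.integral_sq_le_of_three_zeros hw1 hw2 hw3
  have hdg : deriv g = fun x => k * g' x := deriv_arc _ _
  have hdg' : deriv g' = fun x => k * -g x := by
    rw [hg'def, deriv_arc]; funext x; simp only [hgdef, arc]; ring
  -- integration by parts
  have hibp : ∫ x in (-1 : ℝ)..1, g' x * deriv w x = k * ∫ x in (-1 : ℝ)..1, g x * w x := by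
    rw [hg'H.1.integral_mul_deriv_eq_deriv_mul hwH.1, hw1, hw3, hdg']
    simp only [mul_zero, sub_zero, mul_neg, neg_mul, intervalIntegral.integral_neg, mul_assoc,
      intervalIntegral.integral_const_mul]
    ring
  have hgc : Continuous g := (contDiff_arc _ _ (n := 0)).continuous
  have hg'c : Continuous g' := (contDiff_arc _ _ (n := 0)).continuous
  have hwc : ContinuousOn w (uIcc (-1) 1) := hwH.1.continuousOn
  have hu2 : ∫ x in (-1 : ℝ)..1, u x ^ 2 = (∫ x in (-1 : ℝ)..1, g x ^ 2)
      + 2 * (∫ x in (-1 : ℝ)..1, g x * w x) + ∫ x in (-1 : ℝ)..1, w x ^ 2 := by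
    have : (fun x => u x ^ 2) = fun x => g x ^ 2 + 2 * (g x * w x) + w x ^ 2 := by
      funext x; simp only [hw]; ring
    rw [this, intervalIntegral.integral_add, intervalIntegral.integral_add,
      intervalIntegral.integral_const_mul]
    all_goals exact ContinuousOn.intervalIntegrable (by fun_prop)
  have hgw' : IntervalIntegrable (fun x => g' x * deriv w x) volume (-1) 1 :=
    hwH.1.intervalIntegrable_deriv.continuousOn_mul hg'c.continuousOn
  have hdu2 : ∫ x in (-1 : ℝ)..1, deriv u x ^ 2 = k ^ 2 * (∫ x in (-1 : ℝ)..1, g' x ^ 2)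
      + 2 * k * (∫ x in (-1 : ℝ)..1, g' x * deriv w x) + ∫ x in (-1 : ℝ)..1, deriv w x ^ 2 := by
    have : ∫ x in (-1 : ℝ)..1, deriv u x ^ 2 = ∫ x in (-1 : ℝ)..1,
        (k ^ 2 * g' x ^ 2 + 2 * k * (g' x * deriv w x) + deriv w x ^ 2) := by
      refine intervalIntegral.integral_congr_ae ?_
      filter_upwards [hu.1.ae_differentiableAt] with x hx hx'
      have hd : deriv w x = deriv u x - deriv g x :=
        deriv_fun_sub (hx (uIoc_subset_uIcc hx')) (hasDerivAt_arc _ _ x).differentiableAt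
      rw [hd, hdg]; ring
    rw [this, intervalIntegral.integral_add, intervalIntegral.integral_add,
      intervalIntegral.integral_const_mul, intervalIntegral.integral_const_mul]
    · exact ContinuousOn.intervalIntegrable (by fun_prop)
    · exact hgw'.const_mul _
    · exact (ContinuousOn.intervalIntegrable (by fun_prop)).add (hgw'.const_mul _)
    · exact hwH.intervalIntegrable_deriv_sq
  have hwD : 0 ≤ ∫ x in (-1 : ℝ)..1, deriv w x ^ 2 := IsH1.integral_deriv_sq_nonneg w
  have hk2 : k ^ 2 ≤ 5 / 2 := by
    have := Real.pi_lt_d2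
    have := Real.pi_pos
    rw [hk]; nlinarith
  rw [hu2, hdu2, hibp, hgdef, hg'def, integral_arc_sq, integral_arc_sq]
  have h1 := mul_le_mul_of_nonneg_left hP (sq_nonneg k)
  have h2 := mul_le_mul_of_nonneg_right hk2 hwD
  linarith

/-- The square of the scalar `H¹(-1, 1)` norm. -/
noncomputable def h1Sq (u : ℝ → ℝ) : ℝ :=
  (∫ x in (-1 : ℝ)..1, u x ^ 2) + ∫ x in (-1 : ℝ)..1, deriv u x ^ 2

theorem h1Sq_le_of_eq_zero {u : ℝ → ℝ} (hu : IsH1 u) (h : u (-1) = 0) :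
    h1Sq u ≤ 5 * ∫ x in (-1 : ℝ)..1, deriv u x ^ 2 := by
  have := hu.integral_sq_le_of_eq_zero le_rfl le_rfl (c := -1) (by norm_num) h
  norm_num at this
  unfold h1Sq
  linarith

theorem pi_div_two_sq_le : (Real.pi / 2) ^ 2 ≤ 5 / 2 := by
  have := Real.pi_lt_d2
  have := Real.pi_pos
  nlinarith

theorem integral_deriv_arc_sq (α β : ℝ) :
    ∫ x in (-1 : ℝ)..1, deriv (arc α β) x ^ 2 = (Real.pi / 2) ^ 2 * (α ^ 2 + β ^ 2) := by
  simp only [deriv_arc, mul_pow, intervalIntegral.integral_const_mul]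
  have := integral_arc_sq (-β) α
  rw [this]
  ring

theorem isH1_arc (α β : ℝ) : IsH1 (arc α β) := IsH1.of_contDiff (contDiff_arc _ _)

theorem h1Sq_sub_le {u v : ℝ → ℝ} (hu : IsH1 u) (hv : IsH1 v) :
    h1Sq (fun x => u x - v x) ≤ 2 * h1Sq u + 2 * h1Sq v := by
  have h1 : ∫ x in (-1 : ℝ)..1, (u x - v x) ^ 2 ≤
      ∫ x in (-1 : ℝ)..1, (2 * u x ^ 2 + 2 * v x ^ 2) := by
    refine intervalIntegral.integral_mono_on (by norm_num) (hu.sub hv).intervalIntegrable_sq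
      ((hu.intervalIntegrable_sq.const_mul _).add (hv.intervalIntegrable_sq.const_mul _))
      fun x _ => ?_
    linarith [sq_nonneg (u x + v x)]
  have h2 : ∫ x in (-1 : ℝ)..1, deriv (fun y => u y - v y) x ^ 2 ≤
      ∫ x in (-1 : ℝ)..1, (2 * deriv u x ^ 2 + 2 * deriv v x ^ 2) := by
    refine intervalIntegral.integral_mono_ae_restrict (by norm_num)
      (hu.sub hv).intervalIntegrable_deriv_sq
      ((hu.intervalIntegrable_deriv_sq.const_mul _).add
        (hv.intervalIntegrable_deriv_sq.const_mul _)) ?_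
    rw [← restrict_Ioo_eq_restrict_Icc]
    filter_upwards [hu.ae_differentiableAt, hv.ae_differentiableAt] with x hx hx'
    rw [deriv_fun_sub hx hx']
    linarith [sq_nonneg (deriv u x + deriv v x)]
  rw [intervalIntegral.integral_add (hu.intervalIntegrable_sq.const_mul _)
    (hv.intervalIntegrable_sq.const_mul _), intervalIntegral.integral_const_mul,
    intervalIntegral.integral_const_mul] at h1
  rw [intervalIntegral.integral_add (hu.intervalIntegrable_deriv_sq.const_mul _)
    (hv.intervalIntegrable_deriv_sq.const_mul _), intervalIntegral.integral_const_mul,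
    intervalIntegral.integral_const_mul] at h2
  unfold h1Sq
  linarith

theorem h1Sq_arc (α β : ℝ) :
    h1Sq (arc α β) = (1 + (Real.pi / 2) ^ 2) * (α ^ 2 + β ^ 2) := by
  rw [h1Sq, integral_arc_sq, integral_deriv_arc_sq]; ring

/-! ### Energy and norm in coordinates -/

theorem normSq_derivMat {P : ℝ → Mat3} {a b c : ℝ → ℝ} {x : ℝ}
    (hP : ∀ y ∈ Icc (-1 : ℝ) 1, P y = qTensor (a y) (b y) (c y)) (hx : x ∈ Ioo (-1 : ℝ) 1)
    (ha : DifferentiableAt ℝ a x) (hb : DifferentiableAt ℝ b x) :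
    normSq (derivMat P x) = 6 * deriv a x ^ 2 + 2 * (deriv b x ^ 2 + deriv c x ^ 2) := by
  have hev : ∀ i j, (fun y => P y i j) =ᶠ[nhds x] fun y => qTensor (a y) (b y) (c y) i j := by
    intro i j
    filter_upwards [Icc_mem_nhds hx.1 hx.2] with y hy
    rw [hP y hy]
  have hD : derivMat P x = qTensor (deriv a x) (deriv b x) (deriv c x) := by
    ext i j
    simp only [derivMat, Matrix.of_apply, (hev i j).deriv_eq]
    fin_cases i <;> fin_cases j <;>
      simp [qTensor, deriv_fun_sub ha hb, deriv_fun_add ha hb]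
  rw [hD, normSq_qTensor]

section

variable {P : ℝ → Mat3} {a b c : ℝ → ℝ}

theorem ae_normSq_derivMat (ha : IsH1 a) (hb : IsH1 b)
    (hP : ∀ y ∈ Icc (-1 : ℝ) 1, P y = qTensor (a y) (b y) (c y)) :
    ∀ᵐ x ∂volume.restrict (Ioc (-1 : ℝ) 1), normSq (derivMat P x) =
      6 * deriv a x ^ 2 + 2 * (deriv b x ^ 2 + deriv c x ^ 2) := by
  rw [← restrict_Ioo_eq_restrict_Ioc]
  filter_upwards [ha.ae_differentiableAt, hb.ae_differentiableAt,
    ae_restrict_mem measurableSet_Ioo] with x hxa hxb hx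
  exact normSq_derivMat hP hx hxa hxb

theorem h1Norm_sq (ha : IsH1 a) (hb : IsH1 b) (hc : IsH1 c)
    (hP : ∀ y ∈ Icc (-1 : ℝ) 1, P y = qTensor (a y) (b y) (c y)) :
    h1Norm P ^ 2 = 6 * h1Sq a + 2 * h1Sq b + 2 * h1Sq c := by
  have h0 : 0 ≤ ∫ x in (-1 : ℝ)..1, (normSq (P x) + normSq (derivMat P x)) := by
    refine intervalIntegral.integral_nonneg (by norm_num) fun x _ => ?_
    unfold normSq
    positivity
  have h1 : ∫ x in (-1 : ℝ)..1, (normSq (P x) + normSq (derivMat P x)) =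
      ∫ x in (-1 : ℝ)..1, (6 * (a x ^ 2 + deriv a x ^ 2) + 2 * (b x ^ 2 + deriv b x ^ 2)
        + 2 * (c x ^ 2 + deriv c x ^ 2)) := by
    refine intervalIntegral.integral_congr_ae_restrict ?_
    rw [uIoc_of_le (by norm_num)]
    filter_upwards [ae_normSq_derivMat ha hb hP, ae_restrict_mem measurableSet_Ioc] with x hx hx'
    rw [hx, hP x (Ioc_subset_Icc_self hx'), normSq_qTensor]
    ring
  have hI {u : ℝ → ℝ} (hu : IsH1 u) :=
    hu.intervalIntegrable_sq.add hu.intervalIntegrable_deriv_sq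
  rw [h1Norm, Real.sq_sqrt h0, h1, intervalIntegral.integral_add
    (((hI ha).const_mul _).add ((hI hb).const_mul _)) ((hI hc).const_mul _),
    intervalIntegral.integral_add ((hI ha).const_mul _) ((hI hb).const_mul _)]
  simp only [intervalIntegral.integral_const_mul]
  rw [intervalIntegral.integral_add ha.intervalIntegrable_sq ha.intervalIntegrable_deriv_sq,
    intervalIntegral.integral_add hb.intervalIntegrable_sq hb.intervalIntegrable_deriv_sq,
    intervalIntegral.integral_add hc.intervalIntegrable_sq hc.intervalIntegrable_deriv_sq]
  rfl

theorem continuousOn_excess (q : ℝ) (ha : IsH1 a) (hb : IsH1 b) (hc : IsH1 c) :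
    ContinuousOn (fun x => excess q (a x) (b x) (c x)) (Icc (-1) 1) := by
  have h1 := ha.continuousOn
  have h2 := hb.continuousOn
  have h3 := hc.continuousOn
  unfold excess size
  fun_prop

theorem energy_eq {θ : ℝ} (hθ : θ ≤ 8 / 9) (lam : ℝ) (ha : IsH1 a) (hb : IsH1 b) (hc : IsH1 c)
    (hP : ∀ y ∈ Icc (-1 : ℝ) 1, P y = qTensor (a y) (b y) (c y)) :
    energy θ lam P = 1 / lam ^ 2 * (3 * (∫ x in (-1 : ℝ)..1, deriv a x ^ 2)
        + (∫ x in (-1 : ℝ)..1, deriv b x ^ 2) + ∫ x in (-1 : ℝ)..1, deriv c x ^ 2)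
      + ∫ x in (-1 : ℝ)..1, excess (qPlus θ) (a x) (b x) (c x) := by
  have h1 : energy θ lam P = ∫ x in (-1 : ℝ)..1, (1 / lam ^ 2 * (3 * deriv a x ^ 2
      + deriv b x ^ 2 + deriv c x ^ 2) + excess (qPlus θ) (a x) (b x) (c x)) := by
    refine intervalIntegral.integral_congr_ae_restrict ?_
    rw [uIoc_of_le (by norm_num)]
    filter_upwards [ae_normSq_derivMat ha hb hP, ae_restrict_mem measurableSet_Ioc] with x hx hx'
    rw [hx, hP x (Ioc_subset_Icc_self hx'), f_qTensor hθ]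
    ring
  have hex : IntervalIntegrable (fun x => excess (qPlus θ) (a x) (b x) (c x)) volume (-1) 1 := by
    refine ContinuousOn.intervalIntegrable ?_
    rw [uIcc_of_le (by norm_num)]
    exact continuousOn_excess _ ha hb hc
  have ha' := ha.intervalIntegrable_deriv_sq.const_mul 3
  have hab := ha'.add hb.intervalIntegrable_deriv_sq
  rw [h1, intervalIntegral.integral_add
    ((hab.add hc.intervalIntegrable_deriv_sq).const_mul _) hex,
    intervalIntegral.integral_const_mul,
    intervalIntegral.integral_add hab hc.intervalIntegrable_deriv_sq,
    intervalIntegral.integral_add ha' hb.intervalIntegrable_deriv_sq,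
    intervalIntegral.integral_const_mul]

end

/-! ### The limiting map -/

theorem QStar_eq (θ x : ℝ) :
    QStar θ x = qTensor (qPlus θ) (arc (-(3 * qPlus θ)) 0 x) (arc 0 (3 * qPlus θ) x) := by
  have hc := Real.cos_sq (Real.pi / 4 - Real.pi / 4 * x)
  have hs := Real.sin_sq_eq_half_sub (Real.pi / 4 - Real.pi / 4 * x)
  have hsc := Real.sin_two_mul (Real.pi / 4 - Real.pi / 4 * x)
  have h2 : 2 * (Real.pi / 4 - Real.pi / 4 * x) = Real.pi / 2 - Real.pi / 2 * x := by ring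
  rw [h2, Real.cos_pi_div_two_sub] at hc hs
  rw [h2, Real.sin_pi_div_two_sub] at hsc
  ext i j
  fin_cases i <;> fin_cases j <;>
    simp [QStar, uniaxial, nStar, qTensor, arc, hsc]
  all_goals first | ring1 | (simp only [← sq, hc, hs]; ring1)

theorem nStar_neg_one : nStar (-1) = ![0, 0, 1] := by
  have : Real.pi / 4 + Real.pi / 4 = Real.pi / 2 := by ring
  simp [nStar, this]

theorem nStar_one : nStar 1 = ![0, 1, 0] := by
  simp [nStar]

theorem QStar_mem_admissible (θ : ℝ) : QStar θ ∈ admissible θ := by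
  refine ⟨fun _ => qPlus θ, arc (-(3 * qPlus θ)) 0, arc 0 (3 * qPlus θ),
    IsH1.of_contDiff contDiff_const, isH1_arc _ _, isH1_arc _ _, fun x _ => QStar_eq θ x,
    rfl, rfl, ?_⟩
  simp [arc_one, arc_neg_one]

theorem energy_QStar {θ : ℝ} (hθ : θ ≤ 8 / 9) (lam : ℝ) :
    energy θ lam (QStar θ) =
      1 / lam ^ 2 * (2 * (Real.pi / 2) ^ 2 * (3 * qPlus θ) ^ 2) := by
  rw [energy_eq hθ lam (IsH1.of_contDiff contDiff_const) (isH1_arc _ _) (isH1_arc _ _)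
    fun x _ => QStar_eq θ x, integral_deriv_arc_sq, integral_deriv_arc_sq]
  have h (x : ℝ) : excess (qPlus θ) (qPlus θ) (arc (-(3 * qPlus θ)) 0 x)
      (arc 0 (3 * qPlus θ) x) = 0 := by
    refine excess_eq_zero (qPlus_pos θ).le ?_
    unfold arc
    linear_combination 9 * qPlus θ ^ 2 * Real.sin_sq_add_cos_sq (Real.pi / 2 * x)
  simp only [h, deriv_const, intervalIntegral.integral_zero, ne_eq, two_ne_zero,
    not_false_eq_true, zero_pow]
  ring

/-! ### Uniform closeness to the circle of minimizers -/

/-- Along curves of bounded Dirichlet energy, a small integral of the excess forces the excess to be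
uniformly small: such curves are equicontinuous and stay in a compact set. -/
theorem exists_forall_excess_lt (θ D : ℝ) (hθ : θ ≤ 8 / 9) {m : ℝ} (hm : 0 < m) (a₀ b₀ c₀ : ℝ) :
    ∃ κ > 0, ∀ a b c : ℝ → ℝ, IsH1 a → IsH1 b → IsH1 c →
      a (-1) = a₀ → b (-1) = b₀ → c (-1) = c₀ →
      ∫ x in (-1 : ℝ)..1, deriv a x ^ 2 ≤ D → ∫ x in (-1 : ℝ)..1, deriv b x ^ 2 ≤ D →
      ∫ x in (-1 : ℝ)..1, deriv c x ^ 2 ≤ D →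
      ∫ x in (-1 : ℝ)..1, excess (qPlus θ) (a x) (b x) (c x) < κ →
      ∀ x ∈ Icc (-1 : ℝ) 1, excess (qPlus θ) (a x) (b x) (c x) < m := by
  rcases lt_or_ge D 0 with hD | hD
  · refine ⟨1, one_pos, fun a b c _ _ _ _ _ _ h => ?_⟩
    exact absurd (h.trans_lt hD) (not_lt.2 (IsH1.integral_deriv_sq_nonneg a))
  set F : ℝ × ℝ × ℝ → ℝ := fun p => excess (qPlus θ) p.1 p.2.1 p.2.2 with hF
  set K : Set (ℝ × ℝ × ℝ) := Metric.closedBall (a₀, b₀, c₀) √(2 * D) with hK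
  have hKc : IsCompact K := isCompact_closedBall _ _
  have huc := hKc.uniformContinuousOn_of_continuous (continuous_excess (qPlus θ)).continuousOn
  rw [Metric.uniformContinuousOn_iff] at huc
  obtain ⟨δ, hδ, huc⟩ := huc (m / 2) (by positivity)
  -- over intervals of length `l` the curves vary by less than `δ`
  set l := min 1 (δ ^ 2 / (2 * (D + 1))) with hl
  have hl0 : 0 < l := lt_min one_pos (by positivity)
  have hl1 : l ≤ 1 := min_le_left _ _
  have hlD : l * D < δ ^ 2 := by
    have h1 : l * D ≤ δ ^ 2 / (2 * (D + 1)) * D := mul_le_mul_of_nonneg_right (min_le_right _ _) hD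
    have h2 : δ ^ 2 / (2 * (D + 1)) * D < δ ^ 2 := by
      rw [div_mul_eq_mul_div, div_lt_iff₀ (by positivity)]
      nlinarith [sq_pos_of_pos hδ]
    linarith
  refine ⟨l * (m / 2), by positivity, fun a b c ha hb hc ha0 hb0 hc0 haD hbD hcD hint x hx => ?_⟩
  by_contra! hxm
  have hvar {u : ℝ → ℝ} (hu : IsH1 u) (huD : ∫ x in (-1 : ℝ)..1, deriv u x ^ 2 ≤ D)
      {s t : ℝ} (hs : s ∈ Icc (-1 : ℝ) 1) (ht : t ∈ Icc (-1 : ℝ) 1) :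
      (u t - u s) ^ 2 ≤ |t - s| * D :=
    (hu.sq_sub_le le_rfl le_rfl hs ht).trans (mul_le_mul_of_nonneg_left huD (abs_nonneg _))
  have hball {u : ℝ → ℝ} (hu : IsH1 u) (huD : ∫ x in (-1 : ℝ)..1, deriv u x ^ 2 ≤ D)
      {t : ℝ} (ht : t ∈ Icc (-1 : ℝ) 1) : dist (u t) (u (-1)) ≤ √(2 * D) := by
    rw [Real.dist_eq]
    refine Real.abs_le_sqrt ((hvar hu huD (by norm_num) ht).trans ?_)
    refine mul_le_mul_of_nonneg_right ?_ hD
    rw [abs_le]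
    constructor <;> linarith [ht.1, ht.2]
  have hmem {t : ℝ} (ht : t ∈ Icc (-1 : ℝ) 1) : (a t, b t, c t) ∈ K := by
    rw [hK, Metric.mem_closedBall, Prod.dist_eq, Prod.dist_eq, ← ha0, ← hb0, ← hc0]
    exact max_le (hball ha haD ht) (max_le (hball hb hbD ht) (hball hc hcD ht))
  have hclose {u : ℝ → ℝ} (hu : IsH1 u) (huD : ∫ x in (-1 : ℝ)..1, deriv u x ^ 2 ≤ D)
      {t : ℝ} (ht : t ∈ Icc (-1 : ℝ) 1) (htx : |t - x| ≤ l) : dist (u t) (u x) < δ := by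
    rw [Real.dist_eq]
    refine abs_lt_of_sq_lt_sq ?_ hδ.le
    exact ((hvar hu huD hx ht).trans (mul_le_mul_of_nonneg_right htx hD)).trans_lt hlD
  have hlow {t : ℝ} (ht : t ∈ Icc (-1 : ℝ) 1) (htx : |t - x| ≤ l) :
      m / 2 ≤ excess (qPlus θ) (a t) (b t) (c t) := by
    have h1 := huc _ (hmem ht) _ (hmem hx) (by
      rw [Prod.dist_eq, Prod.dist_eq]
      exact max_lt (hclose ha haD ht htx) (max_lt (hclose hb hbD ht htx) (hclose hc hcD ht htx)))
    rw [Real.dist_eq] at h1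
    have h2 := neg_lt_of_abs_lt h1
    simp only at h2
    linarith
  obtain ⟨s, hs1, hs2, hsx⟩ : ∃ s, -1 ≤ s ∧ s + l ≤ 1 ∧ ∀ t ∈ Icc s (s + l), |t - x| ≤ l := by
    rcases le_total x 0 with h | h
    · refine ⟨x, hx.1, by linarith, fun t ht => ?_⟩
      rw [abs_le]; constructor <;> linarith [ht.1, ht.2]
    · refine ⟨x - l, by linarith, by linarith [hx.2], fun t ht => ?_⟩
      rw [abs_le]; constructor <;> linarith [ht.1, ht.2]
  have hsub : Icc s (s + l) ⊆ Icc (-1) 1 := Icc_subset_Icc hs1 hs2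
  have hcont := continuousOn_excess (qPlus θ) ha hb hc
  have hI : IntervalIntegrable (fun x => excess (qPlus θ) (a x) (b x) (c x)) volume (-1) 1 :=
    ContinuousOn.intervalIntegrable (by rwa [uIcc_of_le (by norm_num)])
  have h1 : ∫ _ in s..(s + l), m / 2 ≤
      ∫ x in s..(s + l), excess (qPlus θ) (a x) (b x) (c x) := by
    refine intervalIntegral.integral_mono_on (by linarith) (by simp) ?_
      fun t ht => hlow (hsub ht) (hsx t ht)
    refine ContinuousOn.intervalIntegrable ?_
    rw [uIcc_of_le (by linarith)]
    exact hcont.mono hsub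
  have h2 := intervalIntegral.integral_mono_interval hs1 (by linarith) hs2
    (Filter.Eventually.of_forall fun x => excess_nonneg hθ (a x) (b x) (c x)) hI
  rw [intervalIntegral.integral_const, smul_eq_mul, add_sub_cancel_left] at h1
  linarith

/-- A continuous function that starts at `0` and avoids the value `δ` stays below `δ`. -/
theorem lt_of_forall_ne {g : ℝ → ℝ} {δ : ℝ} (hg : ContinuousOn g (Icc (-1) 1)) (h0 : g (-1) < δ)
    (h : ∀ x ∈ Icc (-1 : ℝ) 1, g x ≠ δ) : ∀ x ∈ Icc (-1 : ℝ) 1, g x < δ := by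
  intro x hx
  by_contra! hle
  obtain ⟨y, hy, hyδ⟩ := intermediate_value_Icc hx.1
    (hg.mono (Icc_subset_Icc_right hx.2)) ⟨h0.le, hle⟩
  exact h y ⟨hy.1, hy.2.trans hx.2⟩ hyδ

/-- A continuous curve that starts on the circle of minimizers and along which the excess is
uniformly small stays near that circle: reaching another zero of the excess would require crossing
a region where it is bounded below. -/
theorem exists_forall_abs_sub_le {θ η : ℝ} (hθ : θ ≤ 8 / 9) (hη : 0 < η) :
    ∃ m > 0, ∀ a b c : ℝ → ℝ, IsH1 a → IsH1 b → IsH1 c →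
      a (-1) = qPlus θ → b (-1) = 3 * qPlus θ → c (-1) = 0 →
      (∀ x ∈ Icc (-1 : ℝ) 1, excess (qPlus θ) (a x) (b x) (c x) < m) →
      ∀ x ∈ Icc (-1 : ℝ) 1, |b x ^ 2 + c x ^ 2 - 9 * qPlus θ ^ 2| ≤ η := by
  have hq := qPlus_pos θ
  set q := qPlus θ
  set δ := min (3 * q) (η / (12 * q)) with hδdef
  have hδ : 0 < δ := lt_min (by positivity) (by positivity)
  have hδ1 : δ ≤ 3 * q := min_le_left _ _
  have hδ2 : 12 * q * δ ≤ η := by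
    have := min_le_right (3 * q) (η / (12 * q))
    rwa [le_div_iff₀' (by positivity)] at this
  refine ⟨min (1 / 2 * δ ^ 2 * q ^ 2) (4 / 9 * δ ^ 2 * q),
    lt_min (by positivity) (by positivity), fun a b c ha hb hc ha0 hb0 hc0 h => ?_⟩
  have hcont : ContinuousOn (fun x => size (a x) (b x) (c x)) (Icc (-1) 1) := by
    have h1 := ha.continuousOn
    have h2 := hb.continuousOn
    have h3 := hc.continuousOn
    unfold size
    fun_prop
  have hs0 : size (a (-1)) (b (-1)) (c (-1)) = 6 * q := by
    rw [ha0, hb0, hc0, size, show 9 * q ^ 2 + 3 * ((3 * q) ^ 2 + 0 ^ 2) = (6 * q) ^ 2 by ring]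
    exact Real.sqrt_sq (by positivity)
  have h1 : ∀ x ∈ Icc (-1 : ℝ) 1, |size (a x) (b x) (c x) - 6 * q| < δ := by
    refine lt_of_forall_ne (hcont.sub continuousOn_const).abs (by simpa [hs0] using hδ) ?_
    intro x hx he
    have := le_excess_of_abs_size_sub_eq hθ hδ1 he
    exact absurd (this.trans_lt (h x hx)) (not_lt.2 (min_le_left _ _))
  have h2 : ∀ x ∈ Icc (-1 : ℝ) 1, |size (a x) (b x) (c x) - 6 * a x| < δ := by
    refine lt_of_forall_ne (hcont.sub (continuousOn_const.mul ha.continuousOn)).abs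
      (by rw [hs0, ha0, sub_self, abs_zero]; exact hδ) ?_
    intro x hx he
    have hs := (h1 x hx).le
    have := le_excess_of_abs_size_sub_six_mul_eq hθ hδ1 hs he
    exact absurd (this.trans_lt (h x hx)) (not_lt.2 (min_le_right _ _))
  intro x hx
  exact (abs_sq_add_sq_sub_le hδ1 (h1 x hx).le (h2 x hx).le).trans hδ2

/-! ### Convergence -/

/-- The quantitative form of the convergence. If a curve `(b, c)` from `(3q, 0)` to `(-3q, 0)` stays
within `σ²` of the circle of radius `3q` in the square of the radius, together with `a` has at most
the Dirichlet energy of the half circle, and meets the upper half plane at `0`, then it is within a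
multiple of `σ` of the upper half circle in `H¹`, and so is `a` of the constant `q`. -/
theorem exists_h1Sq_sub_le {q : ℝ} (hq : 0 < q) :
    ∃ C > 0, ∀ σ : ℝ, 0 < σ → σ ≤ 1 → ∀ a b c : ℝ → ℝ, IsH1 a → IsH1 b → IsH1 c →
      a (-1) = q → b (-1) = 3 * q → b 1 = -3 * q → c (-1) = 0 → c 1 = 0 → 0 ≤ c 0 →
      (∀ x ∈ Icc (-1 : ℝ) 1, |b x ^ 2 + c x ^ 2 - 9 * q ^ 2| ≤ σ ^ 2) →
      3 * (∫ x in (-1 : ℝ)..1, deriv a x ^ 2) + (∫ x in (-1 : ℝ)..1, deriv b x ^ 2)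
        + (∫ x in (-1 : ℝ)..1, deriv c x ^ 2) ≤ 2 * (Real.pi / 2) ^ 2 * (3 * q) ^ 2 →
      6 * h1Sq (fun x => a x - q) + 2 * h1Sq (fun x => b x - arc (-(3 * q)) 0 x)
        + 2 * h1Sq (fun x => c x - arc 0 (3 * q) x) ≤ C * σ ^ 2 := by
  set R := 3 * q with hR
  have hR0 : 0 < R := by positivity
  set C₁ := (146 + 48 * (R + 1)) / (2 * R) with hC₁
  set C₂ := (1 + C₁ ^ 2) / R with hC₂
  refine ⟨640 + 14 * C₁ ^ 2 + 14 * C₂ ^ 2, by positivity, ?_⟩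
  intro σ hσ hσ1 a b c ha hb hc ha0 hb0 hb1 hc0 hc1 hcpos hρ hE
  have hb1' : b 1 = -R := by rw [hb1, hR]; ring
  have hk2 := pi_div_two_sq_le
  have hσσ : σ ^ 2 ≤ σ := by nlinarith
  have hρ' {x : ℝ} (hx : x ∈ Icc (-1 : ℝ) 1) : |b x ^ 2 + c x ^ 2 - R ^ 2| ≤ σ ^ 2 := by
    have := hρ x hx
    rwa [show 9 * q ^ 2 = R ^ 2 by rw [hR]; ring] at this
  -- the remainders after subtraction of arcs
  set w := fun x => b x - arc (-R) (b 0) x with hw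
  set z := fun x => c x - arc 0 (c 0) x with hz
  have hwH : IsH1 w := hb.sub (isH1_arc _ _)
  have hzH : IsH1 z := hc.sub (isH1_arc _ _)
  have hw0 : w (-1) = 0 := by simp [hw, arc_neg_one, hb0]
  have hz0 : z (-1) = 0 := by simp [hz, arc_neg_one, hc0]
  have hwI := integral_deriv_sub_arc_sq_le hb (by rw [hb0, hb1'] ; ring)
  have hzI := integral_deriv_sub_arc_sq_le hc (by rw [hc0, hc1, neg_zero])
  rw [hb1', ← hw] at hwI
  rw [hc1, ← hz] at hzI
  have haD := IsH1.integral_deriv_sq_nonneg a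
  have hwD := IsH1.integral_deriv_sq_nonneg w
  have hzD := IsH1.integral_deriv_sq_nonneg z
  have hint : 2 * (R ^ 2 - σ ^ 2) ≤
      (∫ x in (-1 : ℝ)..1, b x ^ 2) + ∫ x in (-1 : ℝ)..1, c x ^ 2 := by
    rw [← intervalIntegral.integral_add hb.intervalIntegrable_sq hc.intervalIntegrable_sq]
    have h1 : ∫ _ in (-1 : ℝ)..1, (R ^ 2 - σ ^ 2) ≤ ∫ x in (-1 : ℝ)..1, (b x ^ 2 + c x ^ 2) :=
      intervalIntegral.integral_mono_on (by norm_num) (by simp)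
        (hb.intervalIntegrable_sq.add hc.intervalIntegrable_sq)
        fun x hx => by linarith [neg_le_of_abs_le (hρ' hx)]
    rw [intervalIntegral.integral_const, smul_eq_mul] at h1
    linarith
  have hsum : 3 / 8 * (∫ x in (-1 : ℝ)..1, deriv w x ^ 2)
      + 3 / 8 * (∫ x in (-1 : ℝ)..1, deriv z x ^ 2)
      + 3 * (∫ x in (-1 : ℝ)..1, deriv a x ^ 2) ≤ 5 * σ ^ 2 := by
    have h1 := mul_le_mul_of_nonneg_left hint (sq_nonneg (Real.pi / 2))
    have h2 := mul_le_mul_of_nonneg_right hk2 (sq_nonneg σ)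
    linarith
  have hwle : ∫ x in (-1 : ℝ)..1, deriv w x ^ 2 ≤ 14 * σ ^ 2 := by linarith [sq_nonneg σ]
  have hzle : ∫ x in (-1 : ℝ)..1, deriv z x ^ 2 ≤ 14 * σ ^ 2 := by linarith [sq_nonneg σ]
  have hale : ∫ x in (-1 : ℝ)..1, deriv a x ^ 2 ≤ 2 * σ ^ 2 := by linarith [sq_nonneg σ]
  have hsup {u : ℝ → ℝ} (hu : IsH1 u) (hu0 : u (-1) = 0)
      (hD : ∫ x in (-1 : ℝ)..1, deriv u x ^ 2 ≤ 14 * σ ^ 2) {x : ℝ} (hx : x ∈ Icc (-1 : ℝ) 1) :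
      |u x| ≤ 6 * σ := by
    refine abs_le_of_sq_le_sq ?_ (by positivity)
    have h1 := hu.sq_sub_le le_rfl le_rfl (x := -1) (by norm_num) hx
    rw [hu0, sub_zero, abs_of_nonneg (by linarith [hx.1])] at h1
    have h2 : (x - -1) * (∫ x in (-1 : ℝ)..1, deriv u x ^ 2) ≤ 2 * (14 * σ ^ 2) :=
      mul_le_mul (by linarith [hx.2]) hD (IsH1.integral_deriv_sq_nonneg u) (by norm_num)
    linarith [sq_nonneg σ]
  -- evaluation at `±1/2` shows that `b 0` is small
  have hbc {x : ℝ} (hx : x ∈ Icc (-1 : ℝ) 1) : |b x| ≤ R + 1 ∧ |c x| ≤ R + 1 := by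
    have h1 := le_of_abs_le (hρ' hx)
    constructor <;> refine abs_le_of_sq_le_sq ?_ (by positivity) <;>
      nlinarith [sq_nonneg (b x), sq_nonneg (c x)]
  have hprod {s t : ℝ} (hs : |s| ≤ R + 1) (ht : |t| ≤ 6 * σ) : |s * t| ≤ 6 * (R + 1) * σ := by
    rw [abs_mul, show 6 * (R + 1) * σ = (R + 1) * (6 * σ) by ring]
    gcongr
  have hsqw {t : ℝ} (ht : |t| ≤ 6 * σ) : t ^ 2 ≤ 36 * σ := by
    have := sq_le_sq' (neg_le_of_abs_le ht) (le_of_abs_le ht)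
    linarith
  have hb0le : |b 0| ≤ C₁ * σ := by
    have hp : (1 / 2 : ℝ) ∈ Icc (-1 : ℝ) 1 := by norm_num
    have hm : (-1 / 2 : ℝ) ∈ Icc (-1 : ℝ) 1 := by norm_num
    have h2 : (√2 / 2) ^ 2 = 1 / 2 := by
      rw [div_pow, Real.sq_sqrt (by norm_num)]; norm_num
    have e1 : (b (1 / 2) - w (1 / 2)) ^ 2 = 1 / 2 * (b 0 - R) ^ 2 := by
      simp only [hw, arc_half]; linear_combination (b 0 - R) ^ 2 * h2
    have e2 : (b (-1 / 2) - w (-1 / 2)) ^ 2 = 1 / 2 * (b 0 + R) ^ 2 := by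
      simp only [hw, arc_neg_half, ← h2]; ring
    have e3 : (c (1 / 2) - z (1 / 2)) ^ 2 = 1 / 2 * c 0 ^ 2 := by
      simp only [hz, arc_half]; linear_combination c 0 ^ 2 * h2
    have e4 : (c (-1 / 2) - z (-1 / 2)) ^ 2 = 1 / 2 * c 0 ^ 2 := by
      simp only [hz, arc_neg_half, ← h2]; ring
    have w1 := hsup hwH hw0 hwle hp
    have w2 := hsup hwH hw0 hwle hm
    have z1 := hsup hzH hz0 hzle hp
    have z2 := hsup hzH hz0 hzle hm
    have p1 := abs_le.1 (hprod (hbc hp).1 w1)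
    have p2 := abs_le.1 (hprod (hbc hm).1 w2)
    have p3 := abs_le.1 (hprod (hbc hp).2 z1)
    have p4 := abs_le.1 (hprod (hbc hm).2 z2)
    have r1 := abs_le.1 (hρ' hp)
    have r2 := abs_le.1 (hρ' hm)
    have key : 2 * R * b 0 = (b (-1 / 2) - w (-1 / 2)) ^ 2 - (b (1 / 2) - w (1 / 2)) ^ 2
        + (c (-1 / 2) - z (-1 / 2)) ^ 2 - (c (1 / 2) - z (1 / 2)) ^ 2 := by
      rw [e1, e2, e3, e4]; ring
    have hbd : |2 * R * b 0| ≤ (146 + 48 * (R + 1)) * σ := by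
      rw [key, abs_le]
      have := hsqw w1
      have := hsqw w2
      have := hsqw z1
      have := hsqw z2
      constructor <;> linarith [sq_nonneg (w (1 / 2)), sq_nonneg (w (-1 / 2)),
        sq_nonneg (z (1 / 2)), sq_nonneg (z (-1 / 2))]
    rw [abs_mul, abs_of_pos (show 0 < 2 * R by positivity)] at hbd
    rw [hC₁, div_mul_eq_mul_div, le_div_iff₀ (by positivity)]
    linarith
  have hb0sq : b 0 ^ 2 ≤ C₁ ^ 2 * σ ^ 2 := by
    rw [← mul_pow]
    exact sq_le_sq' (neg_le_of_abs_le hb0le) (le_of_abs_le hb0le)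
  -- hence `c 0` is close to `R` in absolute value; its sign rules out `-R`
  have hc0le : |c 0 - R| ≤ C₂ * σ := by
    have r := abs_le.1 (hρ' (x := 0) (by norm_num))
    have h1 : |c 0 - R| * (c 0 + R) ≤ (1 + C₁ ^ 2) * σ := by
      rw [← abs_of_nonneg (show 0 ≤ c 0 + R by positivity), ← abs_mul,
        show (c 0 - R) * (c 0 + R) = c 0 ^ 2 - R ^ 2 by ring]
      have h3 : C₁ ^ 2 * σ ^ 2 ≤ C₁ ^ 2 * σ := by gcongr
      rw [abs_le]
      constructor <;> linarith [sq_nonneg (b 0), mul_nonneg (sq_nonneg C₁) hσ.le]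
    have h2 : |c 0 - R| * R ≤ |c 0 - R| * (c 0 + R) :=
      mul_le_mul_of_nonneg_left (by linarith) (abs_nonneg _)
    rw [hC₂, div_mul_eq_mul_div, le_div_iff₀ hR0]
    linarith
  have hc0sq : (c 0 - R) ^ 2 ≤ C₂ ^ 2 * σ ^ 2 := by
    rw [← mul_pow]
    exact sq_le_sq' (neg_le_of_abs_le hc0le) (le_of_abs_le hc0le)
  have hqH : IsH1 fun _ : ℝ => q := IsH1.of_contDiff contDiff_const
  have f1 : h1Sq (fun x => a x - q) ≤ 10 * σ ^ 2 := by
    have h1 := h1Sq_le_of_eq_zero (ha.sub hqH) (by simp [ha0])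
    simp only [deriv_sub_const] at h1
    linarith
  have hk : 1 + (Real.pi / 2) ^ 2 ≤ 7 / 2 := by linarith
  have f2 : h1Sq (fun x => b x - arc (-R) 0 x) ≤ 140 * σ ^ 2 + 7 * b 0 ^ 2 := by
    have h1 : (fun x => b x - arc (-R) 0 x) = fun x => w x - arc 0 (-b 0) x := by
      funext x; simp only [hw, arc]; ring
    have h2 := h1Sq_sub_le hwH (isH1_arc 0 (-b 0))
    have h3 := h1Sq_le_of_eq_zero hwH hw0
    rw [h1Sq_arc] at h2
    have h4 := mul_le_mul_of_nonneg_right hk (sq_nonneg (b 0))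
    rw [h1]
    linarith
  have f3 : h1Sq (fun x => c x - arc 0 R x) ≤ 140 * σ ^ 2 + 7 * (c 0 - R) ^ 2 := by
    have h1 : (fun x => c x - arc 0 R x) = fun x => z x - arc 0 (R - c 0) x := by
      funext x; simp only [hz, arc]; ring
    have h2 := h1Sq_sub_le hzH (isH1_arc 0 (R - c 0))
    have h3 := h1Sq_le_of_eq_zero hzH hz0
    rw [h1Sq_arc] at h2
    have h4 := mul_le_mul_of_nonneg_right hk (sq_nonneg (c 0 - R))
    rw [h1]
    linarith
  linarith

/-- Comparison with the limiting map bounds the Dirichlet energy of a minimizer by that of the half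
circle, and the excess by a multiple of `λ⁻²`. -/
theorem IsMinimizer.bound {θ lam : ℝ} (hθ : θ ≤ 8 / 9) (hlam : 0 < lam) {Q : ℝ → Mat3}
    (hQ : IsMinimizer θ lam Q) {a b c : ℝ → ℝ} (ha : IsH1 a) (hb : IsH1 b) (hc : IsH1 c)
    (hP : ∀ y ∈ Icc (-1 : ℝ) 1, Q y = qTensor (a y) (b y) (c y)) :
    3 * (∫ x in (-1 : ℝ)..1, deriv a x ^ 2) + (∫ x in (-1 : ℝ)..1, deriv b x ^ 2)
        + (∫ x in (-1 : ℝ)..1, deriv c x ^ 2)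
        + lam ^ 2 * (∫ x in (-1 : ℝ)..1, excess (qPlus θ) (a x) (b x) (c x)) ≤
      2 * (Real.pi / 2) ^ 2 * (3 * qPlus θ) ^ 2 := by
  have h := hQ.2 _ (QStar_mem_admissible θ)
  rw [energy_eq hθ lam ha hb hc hP, energy_QStar hθ] at h
  have h1 := mul_le_mul_of_nonneg_left h (sq_nonneg lam)
  have hne : lam ^ 2 ≠ 0 := by positivity
  rwa [mul_add, ← mul_assoc, ← mul_assoc, mul_one_div_cancel hne, one_mul, one_mul] at h1

end HybridCell

theorem mainTheorem9 (θ : ℝ) (hθ : θ ≤ 8 / 9) :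
    HybridCell.nStar (-1) = ![0, 0, 1] ∧ HybridCell.nStar 1 = ![0, 1, 0] ∧
    HybridCell.QStar θ ∈ HybridCell.admissible θ ∧
    ∀ ε > 0, ∃ Λ > 0, ∀ lam ≥ Λ, ∀ Q : ℝ → HybridCell.Mat3,
      HybridCell.IsMinimizer θ lam Q → 0 ≤ Q 0 1 2 →
        HybridCell.h1Norm (fun x => Q x - HybridCell.QStar θ x) < ε := by
  open HybridCell in
  refine ⟨nStar_neg_one, nStar_one, QStar_mem_admissible θ, fun ε hε => ?_⟩
  have hq := qPlus_pos θ
  obtain ⟨C, hC, hfinal⟩ := exists_h1Sq_sub_le hq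
  -- the `H¹` distance will be at most `√C σ`
  obtain ⟨σ, hσ, hσ1, hσε⟩ : ∃ σ : ℝ, 0 < σ ∧ σ ≤ 1 ∧ C * σ ^ 2 < ε ^ 2 := by
    refine ⟨min 1 (ε / (√C + 1)), lt_min one_pos (by positivity), min_le_left _ _, ?_⟩
    have h1 : √C * min 1 (ε / (√C + 1)) ≤ √C * (ε / (√C + 1)) := by
      gcongr
      exact min_le_right _ _
    have h2 : √C * (ε / (√C + 1)) < ε := by
      rw [← mul_div_assoc, div_lt_iff₀ (by positivity)]
      linarith
    have h3 : (√C * min 1 (ε / (√C + 1))) ^ 2 < ε ^ 2 := by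
      have h0 : 0 ≤ min 1 (ε / (√C + 1)) := le_min zero_le_one (by positivity)
      gcongr
      linarith
    rwa [mul_pow, Real.sq_sqrt hC.le] at h3
  obtain ⟨m, hm, hwell⟩ := exists_forall_abs_sub_le hθ (sq_pos_of_pos hσ)
  set D := 2 * (Real.pi / 2) ^ 2 * (3 * qPlus θ) ^ 2 with hD
  obtain ⟨κ, hκ, hsmall⟩ := exists_forall_excess_lt θ D hθ hm (qPlus θ) (3 * qPlus θ) 0
  have hD0 : 0 ≤ D := by positivity
  refine ⟨√((D + 1) / κ), by positivity, fun lam hlam Q hQ hQ0 => ?_⟩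
  have hlam0 : 0 < lam := lt_of_lt_of_le (by positivity) hlam
  have hlam2 : D + 1 ≤ lam ^ 2 * κ := by
    rw [← div_le_iff₀ hκ]
    exact (Real.sqrt_le_left hlam0.le).1 hlam
  obtain ⟨a, b, c, ha, hb, hc, hP, ha0, -, hb0, hb1, hc0, hc1⟩ := hQ.1
  have hbound := hQ.bound hθ hlam0 ha hb hc hP
  rw [← hD] at hbound
  have haD := IsH1.integral_deriv_sq_nonneg a
  have hbD := IsH1.integral_deriv_sq_nonneg b
  have hcD := IsH1.integral_deriv_sq_nonneg c
  have hex0 : 0 ≤ ∫ x in (-1 : ℝ)..1, excess (qPlus θ) (a x) (b x) (c x) :=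
    intervalIntegral.integral_nonneg (by norm_num) fun x _ => excess_nonneg hθ _ _ _
  have hex0' := mul_nonneg (sq_nonneg lam) hex0
  have hex : ∫ x in (-1 : ℝ)..1, excess (qPlus θ) (a x) (b x) (c x) < κ := by
    by_contra! hle
    have := mul_le_mul_of_nonneg_left hle (sq_nonneg lam)
    linarith
  have hnear := hwell a b c ha hb hc ha0 hb0 hc0 (hsmall a b c ha hb hc ha0 hb0 hc0
    (by linarith) (by linarith) (by linarith) hex)
  have hc00 : 0 ≤ c 0 := by
    rw [hP 0 (by norm_num)] at hQ0
    simpa [qTensor] using hQ0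
  have hfin := hfinal σ hσ hσ1 a b c ha hb hc ha0 hb0 hb1 hc0 hc1 hc00 hnear (by linarith)
  rw [← h1Norm_sq (P := fun x => Q x - QStar θ x)
    (ha.sub (IsH1.of_contDiff contDiff_const)) (hb.sub (isH1_arc _ _)) (hc.sub (isH1_arc _ _))
    fun x hx => ?_] at hfin
  · exact lt_of_pow_lt_pow_left₀ 2 hε.le (hfin.trans_lt hσε)
  · rw [hP x hx, QStar_eq]
    ext i j
    fin_cases i <;> fin_cases j <;> simp [qTensor] <;> ring
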